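/- Let $g:\mathbb N=\{0,1,2,\dots\}\to[0,\infty)$ satisfy $g(0)=0$, $g(k)>0$ for $k\ge1$, and $\sup_k|g(k+1)-g(k)|<\infty$. Let $N\ge2$ be an integer, $\alpha\ge0$, $\theta\ge0$, $I_N=\{1,\dots,N-1\}$ and $\Omega_N=\mathbb N^{I_N}$. Consider the boundary-driven zero-range process, that is, the continuous-time Markov process on $\Omega_N$ whose generator acts on functions $f:\Omega_N\to\mathbb R$ by $$ (L_Nf)(\eta)=\sum_{x\in I_N}\ \sum_{y\in\{x-1,x+1\}\cap I_N}g(\eta(x))\,[f(\eta^{x,y})-f(\eta)] +\frac{\alpha}{N^\theta}[f(\eta^{1+})-f(\eta)]+\frac{g(\eta(N-1))}{N^\theta}[f(\eta^{(N-1)-})-f(\eta)], $$ where $\eta^{x,y}$ is obtained from $\eta$ by moving one particle from $x$ to $y$, and $\eta^{x\pm}$ by adding, respectively removing, one particle at $x$. Write $g(k)!=\prod_{1\le j\le k}g(j)$ (so $g(0)!=1$) and $Z(\varphi)=\sum_{k\ge0}\varphi^k/g(k)!$, and let $\varphi^*\in[0,\infty]$ be the radius of convergence of $Z$. Assume that $$\alpha\Big(\frac1{N^{\theta-1}}-\frac2{N^\theta}+1\Big)<\varphi^*,$$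 and put $$\varphi^N(x)=-\frac{\alpha}{N^\theta}(x+1)+\frac{\alpha}{N^{\theta-1}}+\alpha,\qquad x\in I_N.$$ Let $\bar\nu^N$ be the product measure on $\Omega_N$ with marginals $$\bar\nu^N\{\eta:\eta(x)=k\}=\frac{1}{Z(\varphi^N(x))}\,\frac{\varphi^N(x)^k}{g(k)!},\qquad x\in I_N,\ k\ge0 .$$ Then $\bar\nu^N$ is the unique invariant distribution of this process: it is a probability measure which is invariant, and every invariant probability measure of the process equals $\bar\nu^N$. -/

import Mathlib

open MeasureTheory
open scoped ENNReal

noncomputable section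

/-! ## Continuous-time Markov chains on a countable state space -/

namespace MarkovChain

variable {S : Type*} [DecidableEq S]

/-- The indicator function of the state `y`. -/
def stateIndicator (y : S) : S → ℝ := fun z => if z = y then 1 else 0

/-- The entry `q(x, y) = (L 1_{y})(x)` of the rate matrix of a generator `L` acting on functions.
For `x ≠ y` this is the rate at which the process jumps from `x` to `y`. -/
def jumpRate (L : (S → ℝ) → S → ℝ) (x y : S) : ℝ := L (stateIndicator y) x

/-- The total rate `-q(x, x)` at which the process with generator `L` leaves `x`. -/
def exitRate (L : (S → ℝ) → S → ℝ) (x : S) : ℝ := -jumpRate L x x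

/-- `transitionWithJumps L n t x y` is the probability that the jump process with generator `L`
started from `x` is at `y` at time `t` and has performed exactly `n` jumps during `[0, t]`:
the process waits at `x` for an exponential time of parameter `exitRate L x` and then jumps to
`z ≠ x` with probability `jumpRate L x z / exitRate L x`, from where it starts afresh. -/
def transitionWithJumps (L : (S → ℝ) → S → ℝ) : ℕ → ℝ → S → S → ℝ≥0∞
  | 0, t, x, y => if x = y then ENNReal.ofReal (Real.exp (-exitRate L x * t)) else 0
  | n + 1, t, x, y =>
      ∫⁻ s in Set.Icc 0 t,
        ENNReal.ofReal (Real.exp (-exitRate L x * s)) *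
          ∑' z, (if z = x then 0 else ENNReal.ofReal (jumpRate L x z)) *
            transitionWithJumps L n (t - s) z y

/-- The transition function `P_t(x, y)`, `t ≥ 0`, of the Markov process with generator `L`, that
is, the minimal nonnegative solution of the backward equation of the rate matrix of `L`. -/
def transitionProb (L : (S → ℝ) → S → ℝ) (t : ℝ) (x y : S) : ℝ≥0∞ :=
  ∑' n, transitionWithJumps L n t x y

/-- `μ` is an invariant distribution of the Markov process with generator `L`: it is a probability
measure, and the process started from `μ` has law `μ` at every time `t ≥ 0`. -/
def IsInvariantDistribution [MeasurableSpace S] (L : (S → ℝ) → S → ℝ) (μ : Measure S) : Prop :=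
  IsProbabilityMeasure μ ∧ ∀ t : ℝ, 0 ≤ t → ∀ y : S, ∫⁻ x, transitionProb L t x y ∂μ = μ {y}

end MarkovChain

/-! ## The boundary driven zero-range process -/

namespace ZeroRange

/-- The finite lattice `I_N = {1, …, N - 1}`. -/
abbrev Site (N : ℕ) : Type := ↥(Finset.Icc 1 (N - 1))

/-- The set `Ω_N = ℕ^{I_N}` of configurations. -/
abbrev Config (N : ℕ) : Type := Site N → ℕ

/-- The site `1`. -/
def leftSite {N : ℕ} (hN : 2 ≤ N) : Site N := ⟨1, Finset.mem_Icc.mpr ⟨le_rfl, by omega⟩⟩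

/-- The site `N - 1`. -/
def rightSite {N : ℕ} (hN : 2 ≤ N) : Site N := ⟨N - 1, Finset.mem_Icc.mpr ⟨by omega, le_rfl⟩⟩

/-- The configuration `η^{x,y}`: a particle jumps from `x` to `y`. (If `η x = 0`, such a jump has
rate `g 0 = 0`.) -/
def move {N : ℕ} (η : Config N) (x y : Site N) : Config N :=
  fun z => if z = x then η z - 1 else if z = y then η z + 1 else η z

/-- The configuration `η^{x+}`: a particle is added at `x`. -/
def create {N : ℕ} (η : Config N) (x : Site N) : Config N :=
  fun z => if z = x then η z + 1 else η z

/-- The configuration `η^{x-}`: a particle is removed at `x`. (If `η x = 0`, this has rate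
proportional to `g 0 = 0`.) -/
def annihilate {N : ℕ} (η : Config N) (x : Site N) : Config N :=
  fun z => if z = x then η z - 1 else η z

/-- The generator `L_{N,0}` of the bulk dynamics. -/
def bulkGenerator (N : ℕ) (g : ℕ → ℝ) (f : Config N → ℝ) (η : Config N) : ℝ :=
  ∑ x : Site N, ∑ y : Site N,
    if (y : ℕ) + 1 = x ∨ (y : ℕ) = x + 1 then g (η x) * (f (move η x y) - f η) else 0

/-- The generator `L_{N,b}` of the boundary dynamics. -/
def boundaryGenerator {N : ℕ} (hN : 2 ≤ N) (g : ℕ → ℝ) (α θ : ℝ) (f : Config N → ℝ)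
    (η : Config N) : ℝ :=
  α / (N : ℝ) ^ θ * (f (create η (leftSite hN)) - f η) +
    g (η (rightSite hN)) / (N : ℝ) ^ θ * (f (annihilate η (rightSite hN)) - f η)

/-- The generator `L_N = L_{N,0} + L_{N,b}` of the boundary driven zero-range process. -/
def generator {N : ℕ} (hN : 2 ≤ N) (g : ℕ → ℝ) (α θ : ℝ) (f : Config N → ℝ)
    (η : Config N) : ℝ :=
  bulkGenerator N g f η + boundaryGenerator hN g α θ f η

/-- `g(k)! = g(1) ⋯ g(k)`, with `g(0)! = 1`. -/
def gFactorial (g : ℕ → ℝ) (k : ℕ) : ℝ := ∏ j ∈ Finset.Icc 1 k, g j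

/-- The partition function `Z(φ) = ∑_{k ≥ 0} φ^k / g(k)!`. -/
def partitionFunction (g : ℕ → ℝ) (φ : ℝ) : ℝ := ∑' k : ℕ, φ ^ k / gFactorial g k

/-- The radius of convergence `φ^* ∈ [0, ∞]` of the partition function. -/
def criticalFugacity (g : ℕ → ℝ) : ℝ≥0∞ :=
  (FormalMultilinearSeries.ofScalars ℝ (fun k : ℕ => 1 / gFactorial g k)).radius

/-- The measure on `ℕ` giving mass `φ^k / (g(k)! Z(φ))` to each `k`. -/
def marginal (g : ℕ → ℝ) (φ : ℝ) : Measure ℕ :=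
  Measure.sum fun k : ℕ =>
    ENNReal.ofReal (φ ^ k / (gFactorial g k * partitionFunction g φ)) • Measure.dirac k

/-- The linear fugacity profile `φ^N(x) = -α (x + 1) / N^θ + α / N^{θ - 1} + α`. -/
def fugacity (N : ℕ) (α θ : ℝ) (x : Site N) : ℝ :=
  -(α / (N : ℝ) ^ θ) * ((x : ℕ) + 1 : ℝ) + α / (N : ℝ) ^ (θ - 1) + α

/-- The product measure on `Ω_N` with marginals given by the fugacity profile `φ^N`. -/
def productMeasure (N : ℕ) (g : ℕ → ℝ) (α θ : ℝ) : Measure (Config N) :=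
  Measure.pi fun x : Site N => marginal g (fugacity N α θ x)

end ZeroRange

end

/-! Write `q` for the exit rates. Invariance concerns the minimal process, so solving the balance
equations does not suffice on its own: the chain must also conserve mass. The general theory, on a
countable state space, has three ingredients.

Subinvariance: the probability of following a path with `n` jumps is a convolution in time of
exponential survival functions, one per visited state, weighted by the rates. Convolution is
commutative and associative, so the backward recursion that defines it also holds forwards, by
conditioning on the last jump. Induction on `n` then turns the balance inequality into `p P_t ≤ p`.

Nonexplosion: a function `V` with finite sublevel sets and `L V ≤ r V` makes the probability of `n`
jumps before time `t` vanish as `n → ∞`. Hence `P_t` has row sums one, and `p P_t ≤ p` becomes an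
equality when `p` has mass one.

Uniqueness: the minimum of two invariant distributions is again invariant. If it differed from both,
it would be strictly below both at a state accessible from everywhere, where it must equal one of
them. Irreducibility is not required, which matters at `α = 0`, where the empty configuration is
absorbing.

For the zero-range process, `V` is the particle number plus one and the accessible state is the
empty configuration. The weights satisfy `m x (k + 1) * g (k + 1) = φ x * m x k`, which reduces
balance to a discrete Laplace equation with boundary terms for `φ`, solved by the linear profile. -/

noncomputable section

/-! ### Exponential waiting times and convolution on the half-line -/

namespace MarkovChain

/-- The survival function of an exponential time of parameter `a`, cut off to `[0, ∞)`. -/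
def survival (a : ℝ) : ℝ → ℝ≥0∞ :=
  (Set.Ici 0).indicator fun t => ENNReal.ofReal (Real.exp (-a * t))

theorem measurable_survival (a : ℝ) : Measurable (survival a) := by
  unfold survival
  exact Measurable.indicator (by fun_prop) measurableSet_Ici

theorem survival_of_nonneg {a t : ℝ} (ht : 0 ≤ t) :
    survival a t = ENNReal.ofReal (Real.exp (-a * t)) :=
  Set.indicator_of_mem (Set.mem_Ici.2 ht) _

theorem survival_of_neg {a t : ℝ} (ht : t < 0) : survival a t = 0 :=
  Set.indicator_of_notMem (by simpa using ht) _

theorem survival_lconvolution_of_neg {a t : ℝ} (ht : t < 0) {f : ℝ → ℝ≥0∞}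
    (hf : ∀ s < 0, f s = 0) : (survival a ⋆ₗ f) t = 0 := by
  rw [lconvolution_def]
  refine (lintegral_congr fun s => ?_).trans lintegral_zero
  rcases lt_or_ge s 0 with hs | hs
  · rw [survival_of_neg hs, zero_mul]
  · rw [hf _ (by linarith), mul_zero]

/-- Causality of both factors cuts the integral over the line down to `[0, t]`. This identifies the
integrals in `transitionWithJumps` with genuine convolutions, to which commutativity and
associativity apply. -/
theorem survival_lconvolution_of_nonneg (a t : ℝ) {f : ℝ → ℝ≥0∞}
    (hf : ∀ s < 0, f s = 0) :
    (survival a ⋆ₗ f) t =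
      ∫⁻ s in Set.Icc 0 t, ENNReal.ofReal (Real.exp (-a * s)) * f (t - s) := by
  rw [lconvolution_def, ← lintegral_indicator measurableSet_Icc]
  refine lintegral_congr fun s => ?_
  rcases lt_or_ge s 0 with hs | hs
  · rw [survival_of_neg hs, zero_mul, Set.indicator_of_notMem]
    exact fun h => absurd h.1 (not_le.2 hs)
  · rcases lt_or_ge t s with h | h
    · rw [hf _ (by linarith), mul_zero, Set.indicator_of_notMem]
      exact fun h' => absurd h'.2 (not_le.2 h)
    · rw [survival_of_nonneg hs, Set.indicator_of_mem (Set.mem_Icc.2 ⟨hs, h⟩)]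
      congr 2
      ring

/-- An exponential clock either rings before `t` or survives past it. Every mass estimate below
closes with this identity. -/
theorem lintegral_exponential_density_add (a : ℝ) (ha : 0 ≤ a) {t : ℝ} (ht : 0 ≤ t) :
    (∫⁻ s in Set.Icc 0 t, ENNReal.ofReal (Real.exp (-a * s)) * ENNReal.ofReal a) +
      ENNReal.ofReal (Real.exp (-a * t)) = 1 := by
  have h1 : ∫ s in (0 : ℝ)..t, Real.exp (-a * s) * a = 1 - Real.exp (-a * t) := by
    have : ∀ s ∈ Set.uIcc 0 t,
        HasDerivAt (fun s => -Real.exp (-a * s)) (Real.exp (-a * s) * a) s := by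
      intro s _
      have h := (((hasDerivAt_id s).const_mul (-a)).exp).neg
      simpa using! h
    rw [intervalIntegral.integral_eq_sub_of_hasDerivAt this
      (Continuous.intervalIntegrable (by fun_prop) _ _)]
    simp
    ring
  have h2 : (∫⁻ s in Set.Icc 0 t, ENNReal.ofReal (Real.exp (-a * s)) * ENNReal.ofReal a) =
      ENNReal.ofReal (1 - Real.exp (-a * t)) := by
    rw [← h1, intervalIntegral.integral_of_le ht, ← integral_Icc_eq_integral_Ioc,
      ofReal_integral_eq_lintegral_ofReal]
    · refine lintegral_congr fun s => ?_
      rw [ENNReal.ofReal_mul (Real.exp_nonneg _)]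
    · exact (Continuous.continuousOn (by fun_prop)).integrableOn_Icc
    · exact Filter.Eventually.of_forall fun s => mul_nonneg (Real.exp_nonneg _) ha
  have h3 : Real.exp (-a * t) ≤ 1 := Real.exp_le_one_iff.2 (by nlinarith)
  rw [h2, ← ENNReal.ofReal_add (by linarith) (Real.exp_nonneg _)]
  simp

theorem lconvolution_tsum {ι : Type*} [Countable ι] {f : ℝ → ℝ≥0∞} (hf : Measurable f)
    (c : ι → ℝ≥0∞) {h : ι → ℝ → ℝ≥0∞} (hh : ∀ i, Measurable (h i)) :
    (f ⋆ₗ fun t => ∑' i, c i * h i t) = fun t => ∑' i, c i * (f ⋆ₗ h i) t := by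
  ext t
  simp only [lconvolution_def]
  rw [← lintegral_congr (fun s => ENNReal.tsum_mul_left),
    lintegral_tsum fun i => by have := hh i; fun_prop]
  refine tsum_congr fun i => ?_
  have := hh i
  rw [← lintegral_const_mul _ (by fun_prop)]
  exact lintegral_congr fun s => by ring

/-! ### Path expansion of the transition function and subinvariance -/

section

variable {S : Type*} [DecidableEq S]

/-- The jump rate from `x` to `z`, with the diagonal set to zero. -/
def offDiagRate (L : (S → ℝ) → S → ℝ) (x z : S) : ℝ≥0∞ :=
  if z = x then 0 else ENNReal.ofReal (jumpRate L x z)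

/-- `transitionWithJumps` as a function of time, cut off to `[0, ∞)`. -/
def causalTransition (L : (S → ℝ) → S → ℝ) (n : ℕ) (x y : S) : ℝ → ℝ≥0∞ :=
  (Set.Ici 0).indicator fun t => transitionWithJumps L n t x y

variable (L : (S → ℝ) → S → ℝ)

theorem causalTransition_of_nonneg (n : ℕ) (x y : S) {t : ℝ} (ht : 0 ≤ t) :
    causalTransition L n x y t = transitionWithJumps L n t x y :=
  Set.indicator_of_mem (Set.mem_Ici.2 ht) _

theorem causalTransition_of_neg (n : ℕ) (x y : S) {t : ℝ} (ht : t < 0) :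
    causalTransition L n x y t = 0 :=
  Set.indicator_of_notMem (by simpa using ht) _

theorem causalTransition_zero (x y : S) (t : ℝ) :
    causalTransition L 0 x y t = if x = y then survival (exitRate L x) t else 0 := by
  rcases lt_or_ge t 0 with ht | ht
  · rw [causalTransition_of_neg L _ _ _ ht, survival_of_neg ht, ite_self]
  · rw [causalTransition_of_nonneg L _ _ _ ht, survival_of_nonneg ht]
    rfl

theorem causalTransition_succ (n : ℕ) (x y : S) :
    causalTransition L (n + 1) x y = survival (exitRate L x) ⋆ₗ fun t =>
      ∑' z, offDiagRate L x z * causalTransition L n z y t := by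
  have h0 : ∀ s < 0, ∑' z, offDiagRate L x z * causalTransition L n z y s = 0 := by
    intro s hs
    simp [causalTransition_of_neg L _ _ _ hs]
  ext t
  rcases lt_or_ge t 0 with ht | ht
  · rw [causalTransition_of_neg L _ _ _ ht, survival_lconvolution_of_neg ht h0]
  · rw [causalTransition_of_nonneg L _ _ _ ht, survival_lconvolution_of_nonneg _ _ h0]
    simp only [transitionWithJumps]
    refine setLIntegral_congr_fun measurableSet_Icc fun s hs => ?_
    have : 0 ≤ t - s := by linarith [hs.2]
    simp only [causalTransition_of_nonneg L _ _ _ this]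
    rfl

theorem transitionProb_eq_tsum (x y : S) {t : ℝ} (ht : 0 ≤ t) :
    transitionProb L t x y = ∑' n, causalTransition L n x y t :=
  tsum_congr fun n => (causalTransition_of_nonneg L n x y ht).symm

/-- `tailProb L n x t` is the probability that the process started from `x` performs at least `n`
jumps during `[0, t]`. -/
def tailProb (L : (S → ℝ) → S → ℝ) : ℕ → S → ℝ → ℝ≥0∞
  | 0, _ => (Set.Ici 0).indicator fun _ => 1
  | n + 1, x => survival (exitRate L x) ⋆ₗ fun t => ∑' z, offDiagRate L x z * tailProb L n z t

theorem tailProb_of_neg (n : ℕ) (x : S) {t : ℝ} (ht : t < 0) : tailProb L n x t = 0 := by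
  induction n generalizing x t with
  | zero => exact Set.indicator_of_notMem (by simpa using ht) _
  | succ n ih =>
    exact survival_lconvolution_of_neg ht fun s hs => by simp [ih _ hs]

theorem tailProb_succ (n : ℕ) (x : S) (t : ℝ) :
    tailProb L (n + 1) x t = ∫⁻ s in Set.Icc 0 t,
      ENNReal.ofReal (Real.exp (-exitRate L x * s)) *
        ∑' z, offDiagRate L x z * tailProb L n z (t - s) :=
  survival_lconvolution_of_nonneg _ _ fun s hs => by simp [tailProb_of_neg L n _ hs]

variable [Countable S]

theorem measurable_causalTransition (n : ℕ) (x y : S) :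
    Measurable (causalTransition L n x y) := by
  induction n generalizing x with
  | zero =>
    have : causalTransition L 0 x y = fun t => if x = y then survival (exitRate L x) t else 0 :=
      funext (causalTransition_zero L x y)
    rw [this]
    split_ifs
    · exact measurable_survival _
    · exact measurable_const
  | succ n ih =>
    rw [causalTransition_succ]
    exact measurable_lconvolution _ (measurable_survival _)
      (Measurable.tsum fun z => (ih z).const_mul _)

/-- The forward recursion for the transition probabilities with a given number of jumps. -/
theorem causalTransition_succ' (n : ℕ) (x y : S) :
    causalTransition L (n + 1) x y = survival (exitRate L y) ⋆ₗ fun t =>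
      ∑' z, offDiagRate L z y * causalTransition L n x z t := by
  have hm := measurable_causalTransition L
  have hs : ∀ a, Measurable (survival a) := measurable_survival
  induction n generalizing x with
  | zero =>
    rw [causalTransition_succ]
    -- For a single jump, both recursions give the rate times the convolution of the two survival
    -- functions. The sum over `Unit` puts the constant factor in the form that `lconvolution_tsum`
    -- extracts.
    have h1 : (fun t => ∑' z, offDiagRate L x z * causalTransition L 0 z y t) =
        fun t => ∑' _ : Unit, offDiagRate L x y * survival (exitRate L y) t := by
      ext t
      rw [tsum_eq_single y fun z hz => by rw [causalTransition_zero, if_neg hz, mul_zero]]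
      simp [causalTransition_zero]
    have h2 : (fun t => ∑' z, offDiagRate L z y * causalTransition L 0 x z t) =
        fun t => ∑' _ : Unit, offDiagRate L x y * survival (exitRate L x) t := by
      ext t
      rw [tsum_eq_single x fun z hz => by rw [causalTransition_zero, if_neg hz.symm, mul_zero]]
      simp [causalTransition_zero]
    rw [h1, h2, lconvolution_tsum (hs _) _ fun _ => hs _,
      lconvolution_tsum (hs _) _ fun _ => hs _, lconvolution_comm]
  | succ n ih =>
    rw [causalTransition_succ]
    conv_lhs => simp only [ih]
    conv_rhs => simp only [causalTransition_succ L n x]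
    have hf : ∀ z, Measurable fun t => ∑' w, offDiagRate L w y * causalTransition L n z w t :=
      fun z => Measurable.tsum fun w => (hm _ _ _).const_mul _
    have hb : ∀ w, Measurable fun t => ∑' z, offDiagRate L x z * causalTransition L n z w t :=
      fun w => Measurable.tsum fun z => (hm _ _ _).const_mul _
    rw [lconvolution_tsum (hs _) _ fun z => measurable_lconvolution _ (hs _) (hf z),
      lconvolution_tsum (hs _) _ fun w => measurable_lconvolution _ (hs _) (hb w)]
    simp only [lconvolution_assoc (hs _) (hs _) (hf _),
      lconvolution_assoc (hs _) (hs _) (hb _)]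
    have hc : Measurable (survival (exitRate L x) ⋆ₗ survival (exitRate L y)) :=
      measurable_lconvolution _ (hs _) (hs _)
    -- Both sides now carry the survival functions of the first and the last state. Once these are
    -- commuted, only the order of summation over the second and the penultimate state differs.
    rw [lconvolution_comm (f := survival (exitRate L y))]
    simp only [lconvolution_tsum hc _ fun _ => hm _ _ _, ← ENNReal.tsum_mul_left]
    ext t
    rw [ENNReal.tsum_comm]
    exact tsum_congr fun w => tsum_congr fun z => by ring

/-- A weight satisfying the balance equations is subinvariant. -/
theorem tsum_mul_sum_causalTransition_le (hq : ∀ x, 0 ≤ exitRate L x) (p : S → ℝ≥0∞)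
    (hp : ∀ y, ∑' x, p x * offDiagRate L x y ≤ p y * ENNReal.ofReal (exitRate L y))
    (n : ℕ) (y : S) (t : ℝ) :
    ∑' x, p x * ∑ k ∈ Finset.range n, causalTransition L k x y t ≤ p y := by
  have hm := measurable_causalTransition L
  rcases lt_or_ge t 0 with ht | ht
  · simp [causalTransition_of_neg L _ _ _ ht]
  induction n generalizing y t with
  | zero => simp
  | succ n ih =>
    -- Separate the path without jumps and condition the others on their last jump. The variable `s`
    -- is the time since that jump, spent at `y`.
    have h1 : ∀ x, p x * ∑ k ∈ Finset.range (n + 1), causalTransition L k x y t =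
        p x * causalTransition L 0 x y t +
          ∫⁻ s in Set.Icc 0 t, ENNReal.ofReal (Real.exp (-exitRate L y * s)) *
            ∑' z, offDiagRate L z y *
              (p x * ∑ k ∈ Finset.range n, causalTransition L k x z (t - s)) := by
      intro x
      rw [Finset.sum_range_succ', mul_add, add_comm]
      congr 1
      have h0 : ∀ k, ∀ s < 0, ∑' z, offDiagRate L z y * causalTransition L k x z s = 0 := by
        intro k s hs
        simp [causalTransition_of_neg L _ _ _ hs]
      simp only [causalTransition_succ', survival_lconvolution_of_nonneg _ _ (h0 _)]
      rw [← lintegral_finsetSum, ← lintegral_const_mul]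
      · refine lintegral_congr fun s => ?_
        rw [← Finset.mul_sum, ← Summable.tsum_finsetSum fun _ _ => ENNReal.summable,
          mul_left_comm, ← ENNReal.tsum_mul_left]
        congr 1
        refine tsum_congr fun z => ?_
        rw [← Finset.mul_sum, mul_left_comm]
      · fun_prop
      · intro k _
        fun_prop
    simp only [h1]
    rw [ENNReal.tsum_add, ← lintegral_tsum fun x => by fun_prop]
    rw [tsum_eq_single y fun x hx => by rw [causalTransition_zero, if_neg hx, mul_zero],
      causalTransition_zero, if_pos rfl, survival_of_nonneg ht]
    have h2 : (∫⁻ s in Set.Icc 0 t, ∑' x, ENNReal.ofReal (Real.exp (-exitRate L y * s)) *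
            ∑' z, offDiagRate L z y *
              (p x * ∑ k ∈ Finset.range n, causalTransition L k x z (t - s))) ≤
        ∫⁻ s in Set.Icc 0 t, p y * (ENNReal.ofReal (Real.exp (-exitRate L y * s)) *
          ENNReal.ofReal (exitRate L y)) := by
      refine setLIntegral_mono' measurableSet_Icc fun s hs => ?_
      rw [ENNReal.tsum_mul_left, mul_left_comm (p y)]
      gcongr
      rw [ENNReal.tsum_comm]
      refine le_trans (ENNReal.tsum_le_tsum fun z => ?_) (hp y)
      rw [ENNReal.tsum_mul_left, mul_comm]
      gcongr
      exact ih z (t - s) (by linarith [hs.2])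
    refine (add_le_add_right h2 _).trans ?_
    rw [lintegral_const_mul _ (by fun_prop), ← mul_add, add_comm,
      lintegral_exponential_density_add _ (hq y) ht, mul_one]

theorem tsum_mul_transitionProb_le (hq : ∀ x, 0 ≤ exitRate L x) (p : S → ℝ≥0∞)
    (hp : ∀ y, ∑' x, p x * offDiagRate L x y ≤ p y * ENNReal.ofReal (exitRate L y))
    (y : S) {t : ℝ} (ht : 0 ≤ t) :
    ∑' x, p x * transitionProb L t x y ≤ p y := by
  simp only [transitionProb_eq_tsum L _ _ ht, ← ENNReal.tsum_mul_left]
  rw [ENNReal.tsum_comm, ENNReal.tsum_eq_iSup_nat]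
  refine iSup_le fun n => ?_
  rw [← Summable.tsum_finsetSum fun _ _ => ENNReal.summable]
  simp only [← Finset.mul_sum]
  exact tsum_mul_sum_causalTransition_le L hq p hp n y t

/-! ### Nonexplosion from a Lyapunov function -/

theorem measurable_tailProb (n : ℕ) (x : S) : Measurable (tailProb L n x) := by
  induction n generalizing x with
  | zero => exact measurable_const.indicator measurableSet_Ici
  | succ n ih =>
    exact measurable_lconvolution _ (measurable_survival _)
      (Measurable.tsum fun z => (ih z).const_mul _)

/-- Fewer than `n` jumps and at least `n` jumps are complementary events. The induction conditions
on the first jump and uses that the rates out of `x` add up to its exit rate. -/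
theorem tsum_sum_causalTransition_add_tailProb (hq : ∀ x, 0 ≤ exitRate L x)
    (hR : ∀ x, ∑' z, offDiagRate L x z = ENNReal.ofReal (exitRate L x))
    (n : ℕ) (x : S) {t : ℝ} (ht : 0 ≤ t) :
    ∑' y, ∑ k ∈ Finset.range n, causalTransition L k x y t + tailProb L n x t = 1 := by
  have hm := measurable_causalTransition L
  have hm' := measurable_tailProb L
  induction n generalizing x t with
  | zero => simp [tailProb, ht]
  | succ n ih =>
    have h1 : ∀ y, ∑ k ∈ Finset.range (n + 1), causalTransition L k x y t =
        causalTransition L 0 x y t +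
          ∫⁻ s in Set.Icc 0 t, ENNReal.ofReal (Real.exp (-exitRate L x * s)) *
            ∑' z, offDiagRate L x z *
              ∑ k ∈ Finset.range n, causalTransition L k z y (t - s) := by
      intro y
      rw [Finset.sum_range_succ', add_comm]
      congr 1
      have h0 : ∀ k, ∀ s < 0, ∑' z, offDiagRate L x z * causalTransition L k z y s = 0 := by
        intro k s hs
        simp [causalTransition_of_neg L _ _ _ hs]
      simp only [causalTransition_succ, survival_lconvolution_of_nonneg _ _ (h0 _)]
      rw [← lintegral_finsetSum]
      · refine lintegral_congr fun s => ?_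
        rw [← Finset.mul_sum, ← Summable.tsum_finsetSum fun _ _ => ENNReal.summable]
        simp only [← Finset.mul_sum]
      · intro k _
        fun_prop
    simp only [h1, tailProb_succ]
    rw [ENNReal.tsum_add, ← lintegral_tsum fun x => by fun_prop]
    rw [tsum_eq_single x fun y hy => by rw [causalTransition_zero, if_neg hy.symm],
      causalTransition_zero, if_pos rfl, survival_of_nonneg ht, add_assoc,
      ← lintegral_add_right _ (by fun_prop), add_comm,
      ← lintegral_exponential_density_add _ (hq x) ht]
    congr 1
    refine setLIntegral_congr_fun measurableSet_Icc fun s hs => ?_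
    rw [ENNReal.tsum_mul_left, ← mul_add, ENNReal.tsum_comm, ← ENNReal.tsum_add, ← hR]
    congr 1
    refine tsum_congr fun z => ?_
    rw [ENNReal.tsum_mul_left, ← mul_add, ih z (by linarith [hs.2]), mul_one]

/-- A Lyapunov function controls the probability of performing many jumps. -/
theorem tailProb_le (hq : ∀ x, 0 ≤ exitRate L x)
    (hR : ∀ x, ∑' z, offDiagRate L x z = ENNReal.ofReal (exitRate L x))
    {r : ℝ} (hr : 0 ≤ r) (V : S → ℝ≥0∞)
    (hV : ∀ x, ∑' z, offDiagRate L x z * V z ≤ ENNReal.ofReal (exitRate L x + r) * V x)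
    (b : ℝ≥0∞) (hb : ∀ x, 1 ≤ V x ∨
      ENNReal.ofReal (exitRate L x) ≤ ENNReal.ofReal (exitRate L x + r) * b)
    (n : ℕ) (x : S) {t : ℝ} (ht : 0 ≤ t) :
    tailProb L n x t ≤ ENNReal.ofReal (Real.exp (r * t)) * (V x + b ^ n) := by
  have hexp : ∀ {t : ℝ}, 0 ≤ t → 1 ≤ ENNReal.ofReal (Real.exp (r * t)) := fun ht => by
    rw [ENNReal.one_le_ofReal]
    exact Real.one_le_exp (by positivity)
  induction n generalizing x t with
  | zero =>
    have : tailProb L 0 x t = 1 := Set.indicator_of_mem (Set.mem_Ici.2 ht) _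
    rw [this, pow_zero]
    exact le_trans (by simp) (mul_le_mul' (hexp ht) (le_add_self : (1 : ℝ≥0∞) ≤ V x + 1))
  | succ n ih =>
    rcases hb x with hx | hx
    · have h1 : tailProb L (n + 1) x t ≤ 1 := by
        rw [← tsum_sum_causalTransition_add_tailProb L hq hR (n + 1) x ht]
        exact le_add_self
      exact h1.trans (le_trans (by simp) (mul_le_mul' (hexp ht) (hx.trans le_self_add)))
    · rw [tailProb_succ]
      -- The factor `exp (r * (t - s))` turns the waiting time of parameter `q` into one of
      -- parameter `q + r`, whose density integrates to at most one. The case hypothesis `q ≤ (q +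
      -- r) * b` supplies the additional power of `b`.
      have hle : ∀ s ∈ Set.Icc 0 t, ENNReal.ofReal (Real.exp (-exitRate L x * s)) *
            ∑' z, offDiagRate L x z * tailProb L n z (t - s) ≤
          (ENNReal.ofReal (Real.exp (r * t)) * (V x + b ^ (n + 1))) *
            (ENNReal.ofReal (Real.exp (-(exitRate L x + r) * s)) *
              ENNReal.ofReal (exitRate L x + r)) := by
        intro s hs
        have hsum : ∑' z, offDiagRate L x z * tailProb L n z (t - s) ≤
            ENNReal.ofReal (Real.exp (r * (t - s))) *
              (ENNReal.ofReal (exitRate L x + r) * (V x + b ^ (n + 1))) := by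
          calc _ ≤ ∑' z, offDiagRate L x z *
                (ENNReal.ofReal (Real.exp (r * (t - s))) * (V z + b ^ n)) :=
                ENNReal.tsum_le_tsum fun z =>
                  mul_le_mul_right (ih z (by linarith [hs.2])) _
            _ = ENNReal.ofReal (Real.exp (r * (t - s))) *
                (∑' z, offDiagRate L x z * V z + (∑' z, offDiagRate L x z) * b ^ n) := by
                rw [← ENNReal.tsum_mul_right, ← ENNReal.tsum_add, ← ENNReal.tsum_mul_left]
                exact tsum_congr fun z => by ring
            _ ≤ _ := by
                gcongr
                rw [mul_add, hR, pow_succ', ← mul_assoc]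
                gcongr
                exact hV x
        calc _ ≤ ENNReal.ofReal (Real.exp (-exitRate L x * s)) *
              (ENNReal.ofReal (Real.exp (r * (t - s))) *
              (ENNReal.ofReal (exitRate L x + r) * (V x + b ^ (n + 1)))) :=
              mul_le_mul_right hsum _
          _ = _ := by
              have : ENNReal.ofReal (Real.exp (-exitRate L x * s)) *
                  ENNReal.ofReal (Real.exp (r * (t - s))) =
                  ENNReal.ofReal (Real.exp (r * t)) *
                    ENNReal.ofReal (Real.exp (-(exitRate L x + r) * s)) := by
                rw [← ENNReal.ofReal_mul (Real.exp_nonneg _),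
                  ← ENNReal.ofReal_mul (Real.exp_nonneg _), ← Real.exp_add, ← Real.exp_add]
                ring_nf
              rw [← mul_assoc, this]
              ring
      refine (setLIntegral_mono' measurableSet_Icc hle).trans ?_
      rw [lintegral_const_mul _ (by fun_prop)]
      refine (mul_le_mul_right ?_ _).trans (mul_one _).le
      exact le_self_add.trans
        (lintegral_exponential_density_add _ (add_nonneg (hq x) hr) ht).le

/-- A Markov chain admitting a Lyapunov function along which the exit rates are controlled is
nonexplosive. -/
theorem tsum_transitionProb_eq_one (hq : ∀ x, 0 ≤ exitRate L x)
    (hR : ∀ x, ∑' z, offDiagRate L x z = ENNReal.ofReal (exitRate L x))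
    {r : ℝ} (hr : 0 < r) (V : S → ℝ≥0∞) (hVtop : ∀ x, V x ≠ ∞)
    (hV : ∀ x, ∑' z, offDiagRate L x z * V z ≤ ENNReal.ofReal (exitRate L x + r) * V x)
    (hfin : ∀ M : ℝ≥0∞, M ≠ ∞ → {x | V x < M}.Finite) (x : S) {t : ℝ} (ht : 0 ≤ t) :
    ∑' y, transitionProb L t x y = 1 := by
  have hle : ∀ n, ∑' y, ∑ k ∈ Finset.range n, causalTransition L k x y t ≤
      ∑' y, transitionProb L t x y := fun n => ENNReal.tsum_le_tsum fun y => by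
    rw [transitionProb_eq_tsum L _ _ ht]
    exact ENNReal.sum_le_tsum _
  refine le_antisymm ?_ ?_
  · simp only [transitionProb_eq_tsum L _ _ ht]
    rw [ENNReal.tsum_comm, ENNReal.tsum_eq_iSup_nat]
    refine iSup_le fun n => ?_
    rw [← Summable.tsum_finsetSum fun _ _ => ENNReal.summable,
      ← tsum_sum_causalTransition_add_tailProb L hq hR n x ht]
    exact le_self_add
  -- The tail bound is applied to `e * V`. Exit rates are bounded by some `K'` on the finite set
  -- where `e * V < 1`, so `b = K' / (K' + r) < 1` works there. Letting `n → ∞` removes `b ^ n`;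
  -- afterwards `e` is made small.
  · have key : ∀ e : ℝ≥0∞, e ≠ 0 → e ≠ ∞ → 1 ≤ ∑' y, transitionProb L t x y +
        ENNReal.ofReal (Real.exp (r * t)) * (e * V x) := by
      intro e he he'
      obtain ⟨K, hK⟩ := ((hfin e⁻¹ (ENNReal.inv_ne_top.2 he)).image (exitRate L)).bddAbove
      set K' := max K 0
      set b : ℝ≥0∞ := ENNReal.ofReal (K' / (K' + r)) with hbdef
      have hK0 : 0 ≤ K' := le_max_right _ _
      have hb1 : b < 1 := by
        rw [hbdef, ENNReal.ofReal_lt_one, div_lt_one (by linarith)]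
        linarith
      have hb : ∀ x, 1 ≤ e * V x ∨
          ENNReal.ofReal (exitRate L x) ≤ ENNReal.ofReal (exitRate L x + r) * b := by
        intro x
        by_cases hx : V x < e⁻¹
        · right
          have hxK : exitRate L x ≤ K' := (hK ⟨x, hx, rfl⟩).trans (le_max_left _ _)
          rw [hbdef, ← ENNReal.ofReal_mul (by linarith [hq x])]
          refine ENNReal.ofReal_le_ofReal ?_
          rw [← mul_div_assoc, le_div_iff₀ (by linarith)]
          nlinarith
        · left
          rw [← ENNReal.mul_inv_cancel he he']
          exact mul_le_mul_right (not_lt.1 hx) _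
      have hVe : ∀ x, ∑' z, offDiagRate L x z * (e * V z) ≤
          ENNReal.ofReal (exitRate L x + r) * (e * V x) := by
        intro x
        simp only [mul_left_comm _ e]
        rw [ENNReal.tsum_mul_left]
        exact mul_le_mul_right (hV x) _
      have hn : ∀ n, 1 ≤ ∑' y, transitionProb L t x y +
          ENNReal.ofReal (Real.exp (r * t)) * (e * V x + b ^ n) := by
        intro n
        rw [← tsum_sum_causalTransition_add_tailProb L hq hR n x ht]
        exact add_le_add (hle n) (tailProb_le L hq hR hr.le _ hVe b hb n x ht)
      have hlim : Filter.Tendsto (fun n : ℕ => ∑' y, transitionProb L t x y +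
          ENNReal.ofReal (Real.exp (r * t)) * (e * V x + b ^ n)) Filter.atTop
          (nhds (∑' y, transitionProb L t x y +
            ENNReal.ofReal (Real.exp (r * t)) * (e * V x + 0))) := by
        refine Filter.Tendsto.const_add _ (ENNReal.Tendsto.const_mul ?_ (Or.inr (by simp)))
        exact (ENNReal.tendsto_pow_atTop_nhds_zero_of_lt_one hb1).const_add _
      simpa using ge_of_tendsto' hlim hn
    refine ENNReal.le_of_forall_pos_le_add fun δ hδ _ => ?_
    set c := ENNReal.ofReal (Real.exp (r * t)) * V x with hc
    have hctop : c ≠ ∞ := ENNReal.mul_ne_top ENNReal.ofReal_ne_top (hVtop x)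
    have hc1 : c + 1 ≠ ∞ := by simp [hctop]
    have hδ0 : (δ : ℝ≥0∞) ≠ 0 := by exact_mod_cast hδ.ne'
    -- This choice of `e` makes the error at most `δ`; the `+ 1` keeps the denominator nonzero.
    refine (key (δ / (c + 1)) (ENNReal.div_ne_zero.2 ⟨hδ0, hc1⟩)
      (ENNReal.div_ne_top ENNReal.coe_ne_top (by simp))).trans (add_le_add_right ?_ _)
    calc ENNReal.ofReal (Real.exp (r * t)) * (δ / (c + 1) * V x)
        = δ / (c + 1) * c := by rw [hc]; ring
      _ ≤ δ / (c + 1) * (c + 1) := mul_le_mul_right le_self_add _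
      _ = δ := ENNReal.div_mul_cancel (by simp) hc1

end

/-! ### Existence and uniqueness of invariant distributions -/

/-- A strict inequality at one point would separate the finite sums. This upgrades subinvariance to
invariance whenever mass is conserved. -/
theorem eq_of_le_of_tsum_eq {S : Type*} {f h : S → ℝ≥0∞} (hle : ∀ x, f x ≤ h x)
    (hsum : ∑' x, f x = ∑' x, h x) (hfin : ∑' x, h x ≠ ∞) : f = h := by
  by_contra hne
  obtain ⟨x, hx⟩ := Function.ne_iff.1 hne
  exact (ENNReal.tsum_lt_tsum (hsum ▸ hfin) hle (lt_of_le_of_ne (hle x) hx)).ne hsum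

/-- A stochastic kernel for which some state is accessible in one step from every state has at most
one invariant distribution. -/
theorem eq_of_invariant_of_accessible {S : Type*} (K : S → S → ℝ≥0∞)
    (hK : ∀ x, ∑' y, K x y = 1) (y₀ : S) (hy₀ : ∀ x, K x y₀ ≠ 0) {p p' : S → ℝ≥0∞}
    (hp1 : ∑' x, p x = 1) (hp1' : ∑' x, p' x = 1)
    (hp : ∀ y, ∑' x, p x * K x y = p y) (hp' : ∀ y, ∑' x, p' x * K x y = p' y) : p = p' := by
  set m : S → ℝ≥0∞ := fun x => min (p x) (p' x) with hm
  have hmtop : ∑' x, m x ≠ ∞ :=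
    ne_top_of_le_ne_top (by simp [hp1]) (ENNReal.tsum_le_tsum fun x => min_le_left (p x) (p' x))
  have hmx : ∀ x, m x ≠ ∞ := ENNReal.ne_top_of_tsum_ne_top hmtop
  have hmK : ∀ y, ∑' x, m x * K x y = m y := by
    refine congrFun (eq_of_le_of_tsum_eq (fun y => le_min ?_ ?_) ?_ hmtop)
    · rw [← hp y]
      exact ENNReal.tsum_le_tsum fun x => mul_le_mul_left (min_le_left _ _) _
    · rw [← hp' y]
      exact ENNReal.tsum_le_tsum fun x => mul_le_mul_left (min_le_right _ _) _
    · rw [ENNReal.tsum_comm]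
      simp [ENNReal.tsum_mul_left, hK]
  -- The difference `f - m` is a nonzero mass, and one step of the kernel carries part of it to
  -- `y₀`.
  have hpos : ∀ f : S → ℝ≥0∞, (∀ y, ∑' x, f x * K x y = f y) → (∀ x, m x ≤ f x) →
      f ≠ m → f y₀ ≠ m y₀ := by
    intro f hf hmf hne heq
    obtain ⟨x, hx⟩ := Function.ne_iff.1 hne
    have h1 : ∑' x, m x * K x y₀ < ∑' x, f x * K x y₀ := by
      have hsplit : ∀ x, f x * K x y₀ = (f x - m x) * K x y₀ + m x * K x y₀ := fun x => by
        rw [← add_mul, tsub_add_cancel_of_le (hmf x)]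
      have h2 : ∑' x, (f x - m x) * K x y₀ ≠ 0 := by
        intro h0
        rw [ENNReal.tsum_eq_zero] at h0
        rcases mul_eq_zero.1 (h0 x) with h | h
        · exact hx (le_antisymm (tsub_eq_zero_iff_le.1 h) (hmf x))
        · exact hy₀ x h
      simp only [hsplit]
      rw [ENNReal.tsum_add, hmK, add_comm]
      exact ENNReal.lt_add_right (hmx _) h2
    rw [hmK, hf, heq] at h1
    exact lt_irrefl _ h1
  have hcase : p = m ∨ p' = m := by
    by_contra! h
    have h1 := hpos p hp (fun x => min_le_left _ _) h.1
    have h2 := hpos p' hp' (fun x => min_le_right _ _) h.2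
    rcases min_choice (p y₀) (p' y₀) with h | h
    · exact h1 h.symm
    · exact h2 h.symm
  rcases hcase with h | h
  · exact eq_of_le_of_tsum_eq (fun x => by rw [h]; exact min_le_right _ _)
      (hp1.trans hp1'.symm) (by simp [hp1'])
  · exact (eq_of_le_of_tsum_eq (fun x => by rw [h]; exact min_le_left _ _)
      (hp1'.trans hp1.symm) (by simp [hp1])).symm

section

variable {S : Type*} [DecidableEq S] [Countable S] (L : (S → ℝ) → S → ℝ)

theorem causalTransition_succ_pos {n : ℕ} {x z y : S} (hxz : offDiagRate L x z ≠ 0)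
    (h : ∀ t : ℝ, 0 < t → causalTransition L n z y t ≠ 0) {t : ℝ} (ht : 0 < t) :
    causalTransition L (n + 1) x y t ≠ 0 := by
  have hm := measurable_causalTransition L
  rw [causalTransition_succ, survival_lconvolution_of_nonneg]
  · rw [← pos_iff_ne_zero, setLIntegral_pos_iff (by fun_prop)]
    refine lt_of_lt_of_le ?_ (measure_mono (s := Set.Ioo 0 t) fun s hs => ⟨?_, ?_⟩)
    · simpa using ht
    · rw [Function.mem_support]
      refine mul_ne_zero (by simp [Real.exp_pos]) fun h0 => ?_
      rw [ENNReal.tsum_eq_zero] at h0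
      exact mul_ne_zero hxz (h _ (by linarith [hs.2])) (h0 z)
    · exact Set.Ioo_subset_Icc_self hs
  · intro s hs
    simp [causalTransition_of_neg L _ _ _ hs]

/-- Existence and uniqueness of the invariant distribution of a nonexplosive chain with an
accessible state, from a solution of the balance equations. -/
theorem existsUnique_invariantDistribution [MeasurableSpace S] [MeasurableSingletonClass S]
    (hq : ∀ x, 0 ≤ exitRate L x)
    (hone : ∀ x, ∀ t : ℝ, 0 ≤ t → ∑' y, transitionProb L t x y = 1)
    (y₀ : S) (hy₀ : ∀ x, ∃ n, ∀ t : ℝ, 0 < t → causalTransition L n x y₀ t ≠ 0)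
    (π : Measure S) [IsProbabilityMeasure π]
    (hπ : ∀ y, ∑' x, π {x} * offDiagRate L x y ≤ π {y} * ENNReal.ofReal (exitRate L y)) :
    IsInvariantDistribution L π ∧ ∀ μ, IsInvariantDistribution L μ → μ = π := by
  have hsum : ∀ μ : Measure S, IsProbabilityMeasure μ → ∑' x, μ {x} = 1 := fun μ _ => by
    have := lintegral_countable' (μ := μ) fun _ => 1
    simpa using this.symm
  have hint : ∀ (μ : Measure S) (t : ℝ) (y : S),
      ∫⁻ x, transitionProb L t x y ∂μ = ∑' x, μ {x} * transitionProb L t x y := fun μ t y => by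
    rw [lintegral_countable']
    exact tsum_congr fun x => mul_comm _ _
  have hinv : IsInvariantDistribution L π := by
    refine ⟨inferInstance, fun t ht y => ?_⟩
    rw [hint]
    -- Balance gives the pointwise inequality, and nonexplosion gives both sides total mass one.
    refine congrFun (eq_of_le_of_tsum_eq (f := fun y => ∑' x, π {x} * transitionProb L t x y)
      (h := fun y => π {y}) (fun y => tsum_mul_transitionProb_le L hq _ hπ y ht) ?_
      (by simp [hsum π inferInstance])) y
    rw [ENNReal.tsum_comm]
    simp [ENNReal.tsum_mul_left, hone _ t ht]
  refine ⟨hinv, fun μ hμ => Measure.ext_of_singleton fun y => ?_⟩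
  refine congrFun (eq_of_invariant_of_accessible (transitionProb L 1)
    (fun x => hone x 1 zero_le_one) y₀ (fun x => ?_) (p := fun y => μ {y}) (p' := fun y => π {y})
    (hsum μ hμ.1) (hsum π hinv.1) (fun y => ?_) (fun y => ?_)) y
  · obtain ⟨n, hn⟩ := hy₀ x
    rw [transitionProb_eq_tsum L _ _ zero_le_one]
    exact fun h => hn 1 one_pos (ENNReal.tsum_eq_zero.1 h n)
  · rw [← hint, hμ.2 1 zero_le_one]
  · rw [← hint, hinv.2 1 zero_le_one]

end

end MarkovChain

/-! ### Generators with finitely many transition types -/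

namespace MarkovChain

section

variable {S ι : Type*} [DecidableEq S] [Fintype ι] {L : (S → ℝ) → S → ℝ} {r : ι → S → ℝ}
  {τ : ι → S → S}

/-- No transition with nonzero rate fixes the state, so nothing is lost on the diagonal. -/
theorem exitRate_eq_sum (hL : ∀ f x, L f x = ∑ i, r i x * (f (τ i x) - f x))
    (hτ : ∀ i x, r i x ≠ 0 → τ i x ≠ x) (x : S) : exitRate L x = ∑ i, r i x := by
  rw [exitRate, jumpRate, hL, ← Finset.sum_neg_distrib]
  refine Finset.sum_congr rfl fun i _ => ?_
  by_cases h : r i x = 0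
  · simp [h]
  · simp [stateIndicator, hτ i x h]

theorem offDiagRate_eq_sum (hL : ∀ f x, L f x = ∑ i, r i x * (f (τ i x) - f x))
    (hr : ∀ i x, 0 ≤ r i x) (hτ : ∀ i x, r i x ≠ 0 → τ i x ≠ x) (x z : S) :
    offDiagRate L x z = ∑ i, if τ i x = z then ENNReal.ofReal (r i x) else 0 := by
  rw [offDiagRate]
  split_ifs with h
  · refine (Finset.sum_eq_zero fun i _ => ?_).symm
    split_ifs with h'
    · by_contra h0
      exact hτ i x (fun h1 => h0 (by simp [h1])) (h'.trans h)
    · rfl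
  · rw [jumpRate, hL, ENNReal.ofReal_sum_of_nonneg]
    · refine Finset.sum_congr rfl fun i _ => ?_
      by_cases h' : τ i x = z <;> simp [stateIndicator, Ne.symm h, h']
    · intro i _
      refine mul_nonneg (hr i x) ?_
      by_cases h' : τ i x = z <;> simp [stateIndicator, Ne.symm h, h']

theorem tsum_offDiagRate_mul (hL : ∀ f x, L f x = ∑ i, r i x * (f (τ i x) - f x))
    (hr : ∀ i x, 0 ≤ r i x) (hτ : ∀ i x, r i x ≠ 0 → τ i x ≠ x) (x : S) (F : S → ℝ≥0∞) :
    ∑' z, offDiagRate L x z * F z = ∑ i, ENNReal.ofReal (r i x) * F (τ i x) := by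
  simp only [offDiagRate_eq_sum hL hr hτ, Finset.sum_mul]
  rw [Summable.tsum_finsetSum fun _ _ => ENNReal.summable]
  refine Finset.sum_congr rfl fun i _ => ?_
  rw [tsum_eq_single (τ i x) fun z hz => by rw [if_neg hz.symm, zero_mul], if_pos rfl]

theorem tsum_offDiagRate (hL : ∀ f x, L f x = ∑ i, r i x * (f (τ i x) - f x))
    (hr : ∀ i x, 0 ≤ r i x) (hτ : ∀ i x, r i x ≠ 0 → τ i x ≠ x) (x : S) :
    ∑' z, offDiagRate L x z = ENNReal.ofReal (exitRate L x) := by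
  rw [exitRate_eq_sum hL hτ, ENNReal.ofReal_sum_of_nonneg fun i _ => hr i x]
  simpa using tsum_offDiagRate_mul hL hr hτ x fun _ => 1

theorem offDiagRate_ne_zero (hL : ∀ f x, L f x = ∑ i, r i x * (f (τ i x) - f x))
    (hr : ∀ i x, 0 ≤ r i x) (hτ : ∀ i x, r i x ≠ 0 → τ i x ≠ x) {i : ι} {x : S}
    (h : 0 < r i x) : offDiagRate L x (τ i x) ≠ 0 := by
  rw [offDiagRate_eq_sum hL hr hτ]
  intro h0
  have := Finset.sum_eq_zero_iff.1 h0 i (Finset.mem_univ i)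
  rw [if_pos rfl, ENNReal.ofReal_eq_zero] at this
  exact absurd this (not_le.2 h)

theorem tsum_mul_offDiagRate (hL : ∀ f x, L f x = ∑ i, r i x * (f (τ i x) - f x))
    (hr : ∀ i x, 0 ≤ r i x) (hτ : ∀ i x, r i x ≠ 0 → τ i x ≠ x) (p : S → ℝ≥0∞) (y : S) :
    ∑' x, p x * offDiagRate L x y =
      ∑ i, ∑' x, p x * if τ i x = y then ENNReal.ofReal (r i x) else 0 := by
  rw [← Summable.tsum_finsetSum fun _ _ => ENNReal.summable]
  simp only [offDiagRate_eq_sum hL hr hτ, Finset.mul_sum]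

end

end MarkovChain

/-! ### Configurations and dynamics of the zero-range process -/

namespace ZeroRange

section Configurations

variable {N : ℕ}

theorem create_self (η : Config N) (x : Site N) : create η x x = η x + 1 := by simp [create]

theorem annihilate_create (η : Config N) (x : Site N) : annihilate (create η x) x = η := by
  ext z
  simp only [create, annihilate]
  split_ifs <;> simp

theorem create_annihilate {η : Config N} {x : Site N} (h : η x ≠ 0) :
    create (annihilate η x) x = η := by
  ext z
  simp only [create, annihilate]
  split_ifs with hz
  · subst hz
    omega
  · rfl

theorem move_eq_create_annihilate (η : Config N) {x y : Site N} (h : x ≠ y) :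
    move η x y = create (annihilate η x) y := by
  ext z
  simp only [move, create, annihilate]
  split_ifs with h1 h2 <;> first | rfl | exact absurd (h1.symm.trans h2) h

theorem move_create (η : Config N) {x y : Site N} (h : x ≠ y) :
    move (create η x) x y = create η y := by
  rw [move_eq_create_annihilate _ h, annihilate_create]

theorem create_ne_self (η : Config N) (x : Site N) : create η x ≠ η := fun h => by
  simpa [create] using congrFun h x

theorem sum_mul_create (c : Site N → ℕ) (η : Config N) (x : Site N) :
    ∑ z, c z * create η x z = ∑ z, c z * η z + c x := by
  have h : ∀ z, c z * create η x z = c z * η z + if z = x then c z else 0 := by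
    intro z
    simp only [create]
    split_ifs <;> ring
  simp [h, Finset.sum_add_distrib]

theorem prod_create {M : Type*} [CommMonoid M] (m : Site N → ℕ → M) (η : Config N) (x : Site N) :
    ∏ z, m z (create η x z) = m x (η x + 1) * ∏ z ∈ Finset.univ.erase x, m z (η z) := by
  rw [← Finset.mul_prod_erase _ _ (Finset.mem_univ x), create_self]
  congr 1
  refine Finset.prod_congr rfl fun z hz => ?_
  rw [create, if_neg (Finset.ne_of_mem_erase hz)]

end Configurations

section Dynamics

variable {N : ℕ}

/-- The elementary transitions of the process: jumps, creation on the left and annihilation on the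
right. -/
abbrev Transition (N : ℕ) : Type := (Site N × Site N) ⊕ Bool

/-- Neighbouring sites. -/
abbrev Adjacent (x y : Site N) : Prop := (y : ℕ) + 1 = x ∨ (y : ℕ) = x + 1

/-- The rate of an elementary transition. -/
def rate (hN : 2 ≤ N) (g : ℕ → ℝ) (α θ : ℝ) : Transition N → Config N → ℝ
  | .inl (x, y), η => if Adjacent x y then g (η x) else 0
  | .inr false, _ => α / (N : ℝ) ^ θ
  | .inr true, η => g (η (rightSite hN)) / (N : ℝ) ^ θ

/-- The target of an elementary transition. -/
def target (hN : 2 ≤ N) : Transition N → Config N → Config N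
  | .inl (x, y), η => move η x y
  | .inr false, η => create η (leftSite hN)
  | .inr true, η => annihilate η (rightSite hN)

theorem Adjacent.ne {x y : Site N} (h : Adjacent x y) : x ≠ y := by
  rintro rfl
  rcases h with h | h <;> omega

variable (hN : 2 ≤ N) (g : ℕ → ℝ) (α θ : ℝ)

theorem generator_eq_sum (f : Config N → ℝ) (η : Config N) :
    generator hN g α θ f η =
      ∑ i, rate hN g α θ i η * (f (target hN i η) - f η) := by
  rw [Fintype.sum_sum_type, Fintype.sum_prod_type, Fintype.sum_bool, generator, bulkGenerator,
    boundaryGenerator]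
  simp only [rate, target, ite_mul, zero_mul]
  rw [add_comm (g _ / _ * _)]

variable {g α}

theorem nonneg_of_pos (hg0 : g 0 = 0) (hgpos : ∀ k : ℕ, 1 ≤ k → 0 < g k) (k : ℕ) : 0 ≤ g k := by
  rcases Nat.eq_zero_or_pos k with rfl | hk
  · exact hg0.ge
  · exact (hgpos k hk).le

theorem rate_nonneg (hg0 : g 0 = 0) (hgpos : ∀ k : ℕ, 1 ≤ k → 0 < g k) (hα : 0 ≤ α)
    (i : Transition N) (η : Config N) : 0 ≤ rate hN g α θ i η := by
  have := nonneg_of_pos hg0 hgpos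
  match i with
  | .inl (x, y) =>
    simp only [rate]
    split_ifs
    · exact this _
    · rfl
  | .inr false => exact div_nonneg hα (by positivity)
  | .inr true => exact div_nonneg (this _) (by positivity)

theorem target_ne (hg0 : g 0 = 0) (i : Transition N) (η : Config N)
    (h : rate hN g α θ i η ≠ 0) : target hN i η ≠ η := by
  match i with
  | .inl (x, y) =>
    simp only [rate, ne_eq, ite_eq_right_iff, Classical.not_imp] at h
    have hx : η x ≠ 0 := fun h0 => h.2 (by rw [h0, hg0])
    intro h'
    have := congrFun h' x
    simp only [target, move, if_true] at this
    omega
  | .inr false => exact create_ne_self _ _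
  | .inr true =>
    have hx : η (rightSite hN) ≠ 0 := fun h0 => h (by simp [rate, h0, hg0])
    intro h'
    have := congrFun h' (rightSite hN)
    simp only [target, annihilate, if_true] at this
    omega

/-- From every configuration the empty one can be reached. -/
theorem exists_causalTransition_empty_ne_zero (hg0 : g 0 = 0) (hgpos : ∀ k : ℕ, 1 ≤ k → 0 < g k)
    (hα : 0 ≤ α) (η : Config N) : ∃ n, ∀ t : ℝ, 0 < t →
      MarkovChain.causalTransition (generator hN g α θ) n η 0 t ≠ 0 := by
  have hL := generator_eq_sum hN g α θ
  have hr := rate_nonneg hN θ hg0 hgpos hα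
  have hτ := target_ne hN (α := α) θ hg0
  -- The weight counts the steps each particle needs to leave through the right end. A jump to the
  -- right, or a removal at `N - 1`, lowers it by exactly one.
  induction hw : ∑ z : Site N, (N - (z : ℕ)) * η z using Nat.strong_induction_on generalizing η with
  | _ w ih =>
  by_cases hη : η = 0
  · refine ⟨0, fun t ht => ?_⟩
    rw [MarkovChain.causalTransition_zero, if_pos hη, MarkovChain.survival_of_nonneg ht.le]
    simp [Real.exp_pos]
  obtain ⟨x, hx⟩ := Function.ne_iff.1 hη
  have hx : η x ≠ 0 := hx
  have hxN := Finset.mem_Icc.1 x.2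
  have hgx := hgpos _ (Nat.one_le_iff_ne_zero.2 hx)
  have hsum := sum_mul_create (fun z : Site N => N - (z : ℕ)) (annihilate η x) x
  rw [create_annihilate hx, hw] at hsum
  have step : ∀ i, 0 < rate hN g α θ i η →
      ∑ z : Site N, (N - (z : ℕ)) * target hN i η z < w → ∃ n, ∀ t : ℝ, 0 < t →
      MarkovChain.causalTransition (generator hN g α θ) n η 0 t ≠ 0 := by
    intro i hi hlt
    obtain ⟨n, hn⟩ := ih _ hlt _ rfl
    exact ⟨n + 1, fun t ht => MarkovChain.causalTransition_succ_pos _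
      (MarkovChain.offDiagRate_ne_zero hL hr hτ hi) hn ht⟩
  by_cases hright : (x : ℕ) = N - 1
  · have hxr : x = rightSite hN := Subtype.ext hright
    refine step (.inr true) ?_ ?_
    · simp only [rate, ← hxr]
      have : 0 < N := by omega
      positivity
    · simp only [target, ← hxr]
      omega
  · have hy : (x : ℕ) + 1 ∈ Finset.Icc 1 (N - 1) := Finset.mem_Icc.2 (by omega)
    have hadj : Adjacent x ⟨x + 1, hy⟩ := Or.inr rfl
    refine step (.inl (x, ⟨x + 1, hy⟩)) ?_ ?_
    · simpa only [rate, if_pos hadj] using hgx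
    · simp only [target]
      rw [move_eq_create_annihilate _ hadj.ne,
        sum_mul_create (fun z : Site N => N - (z : ℕ)) (annihilate η x)]
      simp only
      omega

/-- The process does not explode. -/
theorem tsum_transitionProb_eq_one (hg0 : g 0 = 0) (hgpos : ∀ k : ℕ, 1 ≤ k → 0 < g k)
    (hα : 0 ≤ α) (η : Config N) {t : ℝ} (ht : 0 ≤ t) :
    ∑' ξ, MarkovChain.transitionProb (generator hN g α θ) t η ξ = 1 := by
  have hL := generator_eq_sum hN g α θ
  have hr := rate_nonneg hN θ hg0 hgpos hα
  have hτ := target_ne hN (α := α) θ hg0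
  set a := α / (N : ℝ) ^ θ with ha
  have ha0 : 0 ≤ a := div_nonneg hα (by positivity)
  have hq : ∀ η, 0 ≤ MarkovChain.exitRate (generator hN g α θ) η := fun η => by
    rw [MarkovChain.exitRate_eq_sum hL hτ]
    exact Finset.sum_nonneg fun i _ => hr i η
  -- Jumps preserve the particle number and annihilation does not raise it, so only creation at rate
  -- `a` contributes growth. The `+ 1` gives `V ≥ 1`, whence `a ≤ (a + 1) * V`; taking `r = a + 1`
  -- keeps `r` positive even when `α = 0`.
  let V : Config N → ℕ := fun η => ∑ z, 1 * η z + 1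
  have hVc : ∀ η x, V (create η x) = V η + 1 := fun η x => by
    simp only [V]
    rw [sum_mul_create (fun _ => 1)]
  refine MarkovChain.tsum_transitionProb_eq_one _ hq (MarkovChain.tsum_offDiagRate hL hr hτ)
    (r := a + 1) (by linarith) (fun η => (V η : ℝ≥0∞)) (fun η => ENNReal.natCast_ne_top _) ?_ ?_ η ht
  · intro η
    rw [MarkovChain.tsum_offDiagRate_mul hL hr hτ, ENNReal.ofReal_add (hq η) (by linarith), add_mul,
      MarkovChain.exitRate_eq_sum hL hτ, ENNReal.ofReal_sum_of_nonneg fun i _ => hr i η]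
    have hterm : ∀ i, ENNReal.ofReal (rate hN g α θ i η) * (V (target hN i η) : ℝ≥0∞) ≤
        ENNReal.ofReal (rate hN g α θ i η) * V η +
          if i = .inr false then ENNReal.ofReal a else 0 := by
      intro i
      match i with
      | .inl (x, y) =>
        refine le_trans ?_ le_self_add
        by_cases h : rate hN g α θ (.inl (x, y)) η = 0
        · simp [h]
        · have h' := h
          simp only [rate, ite_eq_right_iff, Classical.not_imp] at h'
          have hx : η x ≠ 0 := fun h0 => h'.2 (by rw [h0, hg0])
          have : V (target hN (.inl (x, y)) η) = V η := by
            simp only [target]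
            rw [move_eq_create_annihilate _ (Adjacent.ne h'.1), hVc,
              ← hVc _ x, create_annihilate hx]
          rw [this]
      | .inr false =>
        simp only [target, hVc, if_true, Nat.cast_add, Nat.cast_one, mul_add, mul_one]
        rfl
      | .inr true =>
        refine le_trans (mul_le_mul_right (Nat.cast_le.2 ?_) _) le_self_add
        simp only [target, V, annihilate]
        gcongr
        split_ifs <;> omega
    refine (Finset.sum_le_sum fun i _ => hterm i).trans ?_
    rw [Finset.sum_add_distrib, ← Finset.sum_mul]
    gcongr
    rw [Finset.sum_ite_eq' Finset.univ, if_pos (Finset.mem_univ _)]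
    have h1 : (1 : ℝ≥0∞) ≤ V η := by
      exact_mod_cast Nat.le_add_left 1 _
    calc ENNReal.ofReal a ≤ ENNReal.ofReal (a + 1) * 1 := by
          rw [mul_one]; exact ENNReal.ofReal_le_ofReal (by linarith)
      _ ≤ _ := mul_le_mul_right h1 _
  · intro M hM
    lift M to NNReal using hM
    obtain ⟨k, hk⟩ := exists_nat_ge M
    refine (Set.Finite.pi' (t := fun _ : Site N => Set.Iic k) fun _ => Set.finite_Iic k).subset ?_
    intro η hη z
    have h1 : ((V η : ℕ) : ℝ≥0∞) < (k : ℝ≥0∞) :=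
      lt_of_lt_of_le hη (by exact_mod_cast hk)
    have h2 : V η < k := by exact_mod_cast h1
    have h3 : η z ≤ ∑ z, 1 * η z := by
      simpa using Finset.single_le_sum (f := η) (fun _ _ => Nat.zero_le _) (Finset.mem_univ z)
    simp only [V] at h2
    exact Set.mem_Iic.2 (by omega)

end Dynamics

end ZeroRange

/-! ### Balance equations for the product weights -/

namespace ZeroRange

section Balance

variable {N : ℕ} (hN : 2 ≤ N) {g : ℕ → ℝ} {α : ℝ} (θ : ℝ)

/-- The product weight of a configuration. -/
def productWeight (m : Site N → ℕ → ℝ) (η : Config N) : ℝ := ∏ z, m z (η z)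

/-- The weight of the configuration with one particle removed at `y`, zero if there is none. -/
def removedWeight (m : Site N → ℕ → ℝ) (y : Site N) (ξ : Config N) : ℝ :=
  if ξ y = 0 then 0 else productWeight m (annihilate ξ y)

theorem removedWeight_create (m : Site N → ℕ → ℝ) (y : Site N) (ζ : Config N) :
    removedWeight m y (create ζ y) = productWeight m ζ := by
  rw [removedWeight, create_self, if_neg (Nat.succ_ne_zero _), annihilate_create]

theorem productWeight_create_mul {m : Site N → ℕ → ℝ} {φ : Site N → ℝ}
    (hm : ∀ x k, m x (k + 1) * g (k + 1) = φ x * m x k) (ζ : Config N) (x : Site N) :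
    productWeight m (create ζ x) * g (ζ x + 1) = φ x * productWeight m ζ := by
  rw [productWeight, prod_create, productWeight,
    ← Finset.mul_prod_erase _ _ (Finset.mem_univ x), mul_right_comm, hm, mul_assoc]

/-- The outgoing rate of a particle at `x` is exchanged for the fugacity there. At an empty site `g
0 = 0` agrees with the default value of `removedWeight`. -/
theorem productWeight_mul {m : Site N → ℕ → ℝ} {φ : Site N → ℝ} (hg0 : g 0 = 0)
    (hm : ∀ x k, m x (k + 1) * g (k + 1) = φ x * m x k) (η : Config N) (x : Site N) :
    productWeight m η * g (η x) = φ x * removedWeight m x η := by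
  by_cases hx : η x = 0
  · rw [removedWeight, if_pos hx, hx, hg0, mul_zero, mul_zero]
  · obtain ⟨ζ, rfl⟩ : ∃ ζ, η = create ζ x := ⟨_, (create_annihilate hx).symm⟩
    rw [removedWeight_create, create_self, productWeight_create_mul hm]

/-- The probability flux into `ξ` through an elementary transition. -/
def influx (α θ : ℝ) (m : Site N → ℕ → ℝ) (φ : Site N → ℝ) (ξ : Config N) : Transition N → ℝ
  | .inl (x, y) => if Adjacent x y then φ x * removedWeight m y ξ else 0
  | .inr false => α / (N : ℝ) ^ θ * removedWeight m (leftSite hN) ξ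
  | .inr true => φ (rightSite hN) * productWeight m ξ / (N : ℝ) ^ θ

/-- Each transition is injective on the configurations where its rate is nonzero, so the sum has at
most one nonzero term, the unique predecessor of `ξ`. -/
theorem tsum_productWeight_mul_rate {m : Site N → ℕ → ℝ} {φ : Site N → ℝ} (hg0 : g 0 = 0)
    (hm0 : ∀ x k, 0 ≤ m x k) (hm : ∀ x k, m x (k + 1) * g (k + 1) = φ x * m x k)
    (ξ : Config N) (i : Transition N) :
    ∑' η, ENNReal.ofReal (productWeight m η) *
      (if target hN i η = ξ then ENNReal.ofReal (rate hN g α θ i η) else 0) =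
      ENNReal.ofReal (influx hN α θ m φ ξ i) := by
  have hW : ∀ η, 0 ≤ productWeight m η := fun η => Finset.prod_nonneg fun z _ => hm0 z _
  have hzero : ∀ η, (target hN i η = ξ → rate hN g α θ i η = 0) →
      ENNReal.ofReal (productWeight m η) *
      (if target hN i η = ξ then ENNReal.ofReal (rate hN g α θ i η) else 0) = 0 := by
    intro η h
    split_ifs with h'
    · rw [h h', ENNReal.ofReal_zero, mul_zero]
    · rw [mul_zero]
  have hone : ∀ η, (∀ η', target hN i η' = ξ → rate hN g α θ i η' ≠ 0 → η' = η) →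
      target hN i η = ξ → ∑' η, ENNReal.ofReal (productWeight m η) *
      (if target hN i η = ξ then ENNReal.ofReal (rate hN g α θ i η) else 0) =
      ENNReal.ofReal (productWeight m η * rate hN g α θ i η) := by
    intro η h h'
    rw [tsum_eq_single η, if_pos h', ENNReal.ofReal_mul (hW η)]
    intro η' hne
    exact hzero η' fun ht => by_contra fun h0 => hne (h η' ht h0)
  match i with
  | .inl (x, y) =>
    by_cases hxy : Adjacent x y
    · have hne := hxy.ne
      have hback : ∀ η, target hN (.inl (x, y)) η = ξ →
          rate hN g α θ (.inl (x, y)) η ≠ 0 → ∃ ζ, η = create ζ x ∧ ξ = create ζ y := by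
        intro η ht h0
        simp only [rate, if_pos hxy] at h0
        have hx : η x ≠ 0 := fun h => h0 (by rw [h, hg0])
        refine ⟨annihilate η x, (create_annihilate hx).symm, ?_⟩
        rw [← ht, target, move_eq_create_annihilate _ hne]
      by_cases hy : ξ y = 0
      · rw [ENNReal.tsum_eq_zero.2 fun η => hzero η fun ht => by_contra fun h0 => ?_]
        · simp [influx, removedWeight, hy]
        · obtain ⟨ζ, -, h⟩ := hback η ht h0
          rw [h, create_self] at hy
          omega
      · obtain ⟨ζ, rfl⟩ : ∃ ζ, ξ = create ζ y := ⟨_, (create_annihilate hy).symm⟩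
        rw [hone (create ζ x) ?_ (move_create _ hne)]
        · simp only [rate, influx, if_pos hxy]
          rw [create_self, productWeight_create_mul hm, removedWeight_create]
        · intro η ht h0
          obtain ⟨ζ', rfl, h⟩ := hback η ht h0
          rw [← annihilate_create ζ y, h, annihilate_create]
    · rw [ENNReal.tsum_eq_zero.2 fun η => hzero η fun _ => by simp [rate, if_neg hxy]]
      simp [influx, if_neg hxy]
  | .inr false =>
    by_cases hy : ξ (leftSite hN) = 0
    · rw [ENNReal.tsum_eq_zero.2 fun η => hzero η fun ht => ?_]
      · simp [influx, removedWeight, hy]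
      · rw [← ht, target, create_self] at hy
        omega
    · obtain ⟨ζ, rfl⟩ : ∃ ζ, ξ = create ζ (leftSite hN) := ⟨_, (create_annihilate hy).symm⟩
      rw [hone ζ (fun η ht _ => ?_) rfl]
      · simp only [influx, rate]
        rw [removedWeight_create, mul_comm]
      · rw [← annihilate_create ζ (leftSite hN), ← ht, target, annihilate_create]
  | .inr true =>
    rw [hone (create ξ (rightSite hN)) (fun η ht h0 => ?_) (annihilate_create _ _)]
    · simp only [influx, rate]
      rw [create_self, ← mul_div_assoc, productWeight_create_mul hm]
    · have hx : η (rightSite hN) ≠ 0 := fun h => h0 (by simp [rate, h, hg0])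
      rw [← ht, target, create_annihilate hx]

/-- The fugacity profile solves the traffic equations. -/
theorem traffic_equation (y : Site N) :
    ∑ x : Site N, (if Adjacent x y then fugacity N α θ x - fugacity N α θ y else 0) +
      (if y = leftSite hN then α / (N : ℝ) ^ θ else 0) =
      if y = rightSite hN then α / (N : ℝ) ^ θ else 0 := by
  set a := α / (N : ℝ) ^ θ with ha
  have hy := Finset.mem_Icc.1 y.2
  have hterm : ∀ x : Site N,
      (if Adjacent x y then fugacity N α θ x - fugacity N α θ y else 0) =
        -- At the ends the neighbours `N` and `0` lie outside `Icc 1 (N - 1)`, so membership alone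
        -- removes their terms.
        (fun k : ℕ => (if k = (y : ℕ) + 1 then -a else 0) + if k = (y : ℕ) - 1 then a else 0) x := by
    intro x
    have hx := Finset.mem_Icc.1 x.2
    simp only [Adjacent, fugacity, ← ha]
    by_cases h1 : (x : ℕ) = y + 1
    · rw [if_pos (Or.inl h1.symm), if_pos h1, if_neg (by omega), h1]
      push_cast
      ring
    · by_cases h2 : (y : ℕ) = x + 1
      · rw [if_pos (Or.inr h2), if_neg h1, if_pos (by omega), h2]
        push_cast
        ring
      · rw [if_neg (by omega), if_neg h1, if_neg (by omega), add_zero]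
  rw [Finset.sum_congr rfl fun x _ => hterm x,
    Finset.sum_coe_sort (Finset.Icc 1 (N - 1)) fun k : ℕ =>
      (if k = (y : ℕ) + 1 then -a else 0) + if k = (y : ℕ) - 1 then a else 0,
    Finset.sum_add_distrib, Finset.sum_ite_eq',
    Finset.sum_ite_eq']
  have hl : y = leftSite hN ↔ (y : ℕ) = 1 := Subtype.ext_iff
  have hr : y = rightSite hN ↔ (y : ℕ) = N - 1 := Subtype.ext_iff
  simp only [hl, hr, Finset.mem_Icc]
  split_ifs <;> first | omega | ring

theorem fugacity_rightSite : fugacity N α θ (rightSite hN) = α := by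
  have hN0 : (0 : ℝ) < N := by exact_mod_cast (by omega : 0 < N)
  have h1 : ((rightSite hN : Site N) : ℕ) + 1 = N := by simp only [rightSite]; omega
  have h2 : (((rightSite hN : Site N) : ℕ) : ℝ) + 1 = N := by exact_mod_cast h1
  rw [fugacity, h2, Real.rpow_sub hN0, Real.rpow_one]
  have : (N : ℝ) ^ θ ≠ 0 := (Real.rpow_pos_of_pos hN0 θ).ne'
  field_simp
  ring

/-- Since the fugacity at the right end is `α`, the influx from annihilation cancels the outflux
from creation. In what remains, the coefficient of each `removedWeight m y ξ` is the traffic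
equation at `y`. -/
theorem sum_influx {m : Site N → ℕ → ℝ} (hg0 : g 0 = 0)
    (hm : ∀ x k, m x (k + 1) * g (k + 1) = fugacity N α θ x * m x k) (ξ : Config N) :
    ∑ i, influx hN α θ m (fugacity N α θ) ξ i =
      productWeight m ξ * ∑ i, rate hN g α θ i ξ := by
  have hout : ∀ x, productWeight m ξ * g (ξ x) = fugacity N α θ x * removedWeight m x ξ :=
    productWeight_mul hg0 hm ξ
  rw [Finset.mul_sum]
  simp only [Fintype.sum_sum_type, Fintype.sum_prod_type, Fintype.sum_bool, influx, rate, mul_ite,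
    mul_zero, ← mul_div_assoc, hout, fugacity_rightSite]
  have hsym : ∑ x : Site N, ∑ y : Site N,
        (if Adjacent x y then fugacity N α θ x * removedWeight m x ξ else 0) =
      ∑ x : Site N, ∑ y : Site N,
        (if Adjacent x y then fugacity N α θ y * removedWeight m y ξ else 0) := by
    rw [Finset.sum_comm]
    refine Finset.sum_congr rfl fun x _ => Finset.sum_congr rfl fun y _ => ?_
    refine if_congr ?_ rfl rfl
    simp only [Adjacent]
    omega
  rw [hsym, Finset.sum_comm, Finset.sum_comm (f := fun x y : Site N =>
    if Adjacent x y then fugacity N α θ y * removedWeight m y ξ else 0)]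
  have hflow : ∑ y : Site N, ∑ x : Site N,
        (if Adjacent x y then fugacity N α θ x * removedWeight m y ξ else 0) +
        α / (N : ℝ) ^ θ * removedWeight m (leftSite hN) ξ =
      ∑ y : Site N, ∑ x : Site N,
        (if Adjacent x y then fugacity N α θ y * removedWeight m y ξ else 0) +
        α / (N : ℝ) ^ θ * removedWeight m (rightSite hN) ξ := by
    have h := Finset.sum_congr (rfl : (Finset.univ : Finset (Site N)) = _) fun y _ =>
      congrArg (· * removedWeight m y ξ) (traffic_equation hN (α := α) θ y)
    simp only [add_mul, ite_mul, zero_mul, Finset.sum_add_distrib, Finset.sum_ite_eq',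
      Finset.mem_univ, if_true, Finset.sum_mul] at h
    have hsplit : ∑ y : Site N, ∑ x : Site N,
          (if Adjacent x y then fugacity N α θ x * removedWeight m y ξ else 0) =
        ∑ y : Site N, ∑ x : Site N, (if Adjacent x y then
          (fugacity N α θ x - fugacity N α θ y) * removedWeight m y ξ else 0) +
        ∑ y : Site N, ∑ x : Site N,
          (if Adjacent x y then fugacity N α θ y * removedWeight m y ξ else 0) := by
      rw [← Finset.sum_add_distrib]
      refine Finset.sum_congr rfl fun y _ => ?_
      rw [← Finset.sum_add_distrib]
      refine Finset.sum_congr rfl fun x _ => ?_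
      split_ifs <;> ring
    linear_combination h + hsplit
  linear_combination hflow

/-- The balance equations for the product weights. -/
theorem tsum_productWeight_mul_offDiagRate {m : Site N → ℕ → ℝ} (hg0 : g 0 = 0)
    (hgpos : ∀ k : ℕ, 1 ≤ k → 0 < g k) (hα : 0 ≤ α) (hφ : ∀ x, 0 ≤ fugacity N α θ x)
    (hm0 : ∀ x k, 0 ≤ m x k)
    (hm : ∀ x k, m x (k + 1) * g (k + 1) = fugacity N α θ x * m x k) (ξ : Config N) :
    ∑' η, ENNReal.ofReal (productWeight m η) *
        MarkovChain.offDiagRate (generator hN g α θ) η ξ =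
      ENNReal.ofReal (productWeight m ξ) *
        ENNReal.ofReal (MarkovChain.exitRate (generator hN g α θ) ξ) := by
  have hL := generator_eq_sum hN g α θ
  have hτ := target_ne hN (α := α) θ hg0
  have hW : ∀ η, 0 ≤ productWeight m η := fun η => Finset.prod_nonneg fun z _ => hm0 z _
  have hD : ∀ y, 0 ≤ removedWeight m y ξ := fun y => by
    unfold removedWeight
    split_ifs
    exacts [le_rfl, hW _]
  rw [MarkovChain.tsum_mul_offDiagRate hL (rate_nonneg hN θ hg0 hgpos hα) hτ,
    MarkovChain.exitRate_eq_sum hL hτ, ← ENNReal.ofReal_mul (hW ξ), ← sum_influx hN θ hg0 hm,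
    ENNReal.ofReal_sum_of_nonneg]
  · exact Finset.sum_congr rfl fun i _ => tsum_productWeight_mul_rate hN θ hg0 hm0 hm ξ i
  · intro i _
    have hN0 : (0 : ℝ) ≤ (N : ℝ) ^ θ := by positivity
    match i with
    | .inl (x, y) =>
      simp only [influx]
      split_ifs
      exacts [mul_nonneg (hφ x) (hD y), le_rfl]
    | .inr false => exact mul_nonneg (div_nonneg hα hN0) (hD _)
    | .inr true => exact div_nonneg (mul_nonneg (hφ _) (hW _)) hN0

end Balance

/-! ### Normalisation of the marginals and bounds on the fugacity -/

section Marginal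

variable {g : ℕ → ℝ}

theorem gFactorial_pos (hgpos : ∀ k : ℕ, 1 ≤ k → 0 < g k) (k : ℕ) : 0 < gFactorial g k :=
  Finset.prod_pos fun j hj => hgpos j (Finset.mem_Icc.1 hj).1

theorem gFactorial_succ (k : ℕ) : gFactorial g (k + 1) = gFactorial g k * g (k + 1) :=
  Finset.prod_Icc_succ_top (by omega) _

theorem summable_partitionFunction (hgpos : ∀ k : ℕ, 1 ≤ k → 0 < g k) {φ : ℝ} (hφ : 0 ≤ φ)
    (h : ENNReal.ofReal φ < criticalFugacity g) :
    Summable fun k : ℕ => φ ^ k / gFactorial g k := by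
  have hs := FormalMultilinearSeries.summable_norm_mul_pow _ h
  refine hs.congr fun k => ?_
  rw [FormalMultilinearSeries.ofScalars_norm, Real.norm_of_nonneg
    (div_nonneg zero_le_one (gFactorial_pos hgpos k).le), Real.coe_toNNReal _ hφ]
  ring

theorem partitionFunction_pos (hgpos : ∀ k : ℕ, 1 ≤ k → 0 < g k) {φ : ℝ} (hφ : 0 ≤ φ)
    (h : ENNReal.ofReal φ < criticalFugacity g) : 0 < partitionFunction g φ :=
  (summable_partitionFunction hgpos hφ h).tsum_pos
    (fun k => div_nonneg (pow_nonneg hφ k) (gFactorial_pos hgpos k).le) 0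
    (by simp [gFactorial])

theorem marginal_singleton (g : ℕ → ℝ) (φ : ℝ) (k : ℕ) :
    marginal g φ {k} =
      ENNReal.ofReal (φ ^ k / (gFactorial g k * partitionFunction g φ)) := by
  rw [marginal, Measure.sum_apply _ (measurableSet_singleton k), tsum_eq_single k]
  · simp
  · intro j hj
    simp [hj]

theorem isProbabilityMeasure_marginal (hgpos : ∀ k : ℕ, 1 ≤ k → 0 < g k) {φ : ℝ} (hφ : 0 ≤ φ)
    (h : ENNReal.ofReal φ < criticalFugacity g) : IsProbabilityMeasure (marginal g φ) := by
  have hZ := partitionFunction_pos hgpos hφ h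
  constructor
  have hsum := lintegral_countable' (μ := marginal g φ) fun _ => 1
  simp only [marginal_singleton, lintegral_one, one_mul, ← div_div] at hsum
  rw [hsum, ← ENNReal.ofReal_tsum_of_nonneg, tsum_div_const, ← partitionFunction, div_self hZ.ne',
    ENNReal.ofReal_one]
  · exact fun k => div_nonneg (div_nonneg (pow_nonneg hφ k) (gFactorial_pos hgpos k).le) hZ.le
  · exact (summable_partitionFunction hgpos hφ h).div_const _

end Marginal

/-- The profile is nonincreasing and ends at the value `α` at site `N - 1`. -/
theorem fugacity_nonneg {N : ℕ} (hN : 2 ≤ N) {α : ℝ} (hα : 0 ≤ α) (θ : ℝ) (x : Site N) :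
    0 ≤ fugacity N α θ x := by
  have hx := Finset.mem_Icc.1 x.2
  have hxN : ((x : ℕ) : ℝ) ≤ ((rightSite hN : Site N) : ℕ) := Nat.cast_le.2 hx.2
  have h := fugacity_rightSite hN (α := α) θ
  have ha : 0 ≤ α / (N : ℝ) ^ θ := by positivity
  simp only [fugacity] at h ⊢
  nlinarith [mul_le_mul_of_nonneg_left hxN ha]

/-- The bound is the value at site `1`, where the profile is largest. -/
theorem fugacity_le {N : ℕ} {α : ℝ} (hα : 0 ≤ α) (θ : ℝ) (x : Site N) :
    fugacity N α θ x ≤ α * (1 / (N : ℝ) ^ (θ - 1) - 2 / (N : ℝ) ^ θ + 1) := by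
  have hx : (1 : ℝ) ≤ (x : ℕ) := by exact_mod_cast (Finset.mem_Icc.1 x.2).1
  have ha : 0 ≤ α / (N : ℝ) ^ θ := by positivity
  have h : α * (1 / (N : ℝ) ^ (θ - 1) - 2 / (N : ℝ) ^ θ + 1) =
      -(α / (N : ℝ) ^ θ) * (1 + 1) + α / (N : ℝ) ^ (θ - 1) + α := by ring
  rw [h, fugacity]
  nlinarith [mul_le_mul_of_nonneg_left hx ha]

end ZeroRange

end

theorem lemma1 (g : ℕ → ℝ) (hg0 : g 0 = 0) (hgpos : ∀ k : ℕ, 1 ≤ k → 0 < g k)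
    (hgvar : BddAbove (Set.range fun k : ℕ => |g (k + 1) - g k|))
    (N : ℕ) (hN : 2 ≤ N) (α θ : ℝ) (hα : 0 ≤ α) (hθ : 0 ≤ θ)
    (hφ : ENNReal.ofReal (α * (1 / (N : ℝ) ^ (θ - 1) - 2 / (N : ℝ) ^ θ + 1)) <
      ZeroRange.criticalFugacity g) :
    (∀ (x : ZeroRange.Site N) (k : ℕ),
      ZeroRange.productMeasure N g α θ {η | η x = k} =
        ENNReal.ofReal (ZeroRange.fugacity N α θ x ^ k /
          (ZeroRange.gFactorial g k *
            ZeroRange.partitionFunction g (ZeroRange.fugacity N α θ x)))) ∧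
    MarkovChain.IsInvariantDistribution (ZeroRange.generator hN g α θ)
      (ZeroRange.productMeasure N g α θ) ∧
    ∀ μ : MeasureTheory.Measure (ZeroRange.Config N),
      MarkovChain.IsInvariantDistribution (ZeroRange.generator hN g α θ) μ →
        μ = ZeroRange.productMeasure N g α θ := by
  have hnn := ZeroRange.fugacity_nonneg hN hα θ
  have hcrit : ∀ x, ENNReal.ofReal (ZeroRange.fugacity N α θ x) < ZeroRange.criticalFugacity g :=
    fun x => (ENNReal.ofReal_le_ofReal (ZeroRange.fugacity_le hα θ x)).trans_lt hφ
  have hZ := fun x => ZeroRange.partitionFunction_pos hgpos (hnn x) (hcrit x)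
  have hprob := fun x => ZeroRange.isProbabilityMeasure_marginal hgpos (hnn x) (hcrit x)
  let m : ZeroRange.Site N → ℕ → ℝ := fun x k => ZeroRange.fugacity N α θ x ^ k /
    (ZeroRange.gFactorial g k * ZeroRange.partitionFunction g (ZeroRange.fugacity N α θ x))
  have hm0 : ∀ x k, 0 ≤ m x k := fun x k => div_nonneg (pow_nonneg (hnn x) k)
    (mul_nonneg (ZeroRange.gFactorial_pos hgpos k).le (hZ x).le)
  -- The partition function cancels. Besides nonnegativity, this recursion is all that the balance
  -- equations use of the marginals.
  have hm : ∀ x k, m x (k + 1) * g (k + 1) = ZeroRange.fugacity N α θ x * m x k := by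
    intro x k
    have h1 := (ZeroRange.gFactorial_pos hgpos k).ne'
    have h2 := (hgpos (k + 1) (by omega)).ne'
    have h3 := (hZ x).ne'
    simp only [m]
    rw [ZeroRange.gFactorial_succ]
    field_simp
    ring
  have hsingle : ∀ η, ZeroRange.productMeasure N g α θ {η} =
      ENNReal.ofReal (ZeroRange.productWeight m η) := by
    intro η
    rw [ZeroRange.productMeasure, ← Set.univ_pi_singleton, MeasureTheory.Measure.pi_pi,
      ZeroRange.productWeight, ENNReal.ofReal_prod_of_nonneg fun x _ => hm0 x _]
    exact Finset.prod_congr rfl fun x _ => ZeroRange.marginal_singleton g _ _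
  have hprod : MeasureTheory.IsProbabilityMeasure (ZeroRange.productMeasure N g α θ) := by
    unfold ZeroRange.productMeasure
    infer_instance
  refine ⟨fun x k => ?_, MarkovChain.existsUnique_invariantDistribution _ (fun η => ?_)
    (fun η t ht => ZeroRange.tsum_transitionProb_eq_one hN θ hg0 hgpos hα η ht) 0
    (ZeroRange.exists_causalTransition_empty_ne_zero hN θ hg0 hgpos hα) _ fun ξ => ?_⟩
  · rw [← ZeroRange.marginal_singleton]
    exact (MeasureTheory.measurePreserving_eval
      (fun x => ZeroRange.marginal g (ZeroRange.fugacity N α θ x)) x).measure_preimage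
      (measurableSet_singleton k).nullMeasurableSet
  · rw [MarkovChain.exitRate_eq_sum (ZeroRange.generator_eq_sum hN g α θ)
      (ZeroRange.target_ne hN θ hg0)]
    exact Finset.sum_nonneg fun i _ => ZeroRange.rate_nonneg hN θ hg0 hgpos hα i η
  · simp only [hsingle]
    exact (ZeroRange.tsum_productWeight_mul_offDiagRate hN θ hg0 hgpos hα hnn hm0 hm ξ).le
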